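/- Let $X=\{X_n\}_{n\in\mathbb Z}$ be a real second-order stationary time series with autocovariance function $\gamma_X(h)=\mathrm{Cov}(X_h,X_0)$ and spectral density $f_X$, i.e. a nonnegative, even, integrable function on $(-\pi,\pi)$ with $\gamma_X(h)=\int_{-\pi}^{\pi}e^{ih\lambda}f_X(\lambda)\,d\lambda$ for all $h\in\mathbb Z$. Suppose that $X$ exhibits cyclical long memory (CLM) in the spectral domain: for some $\lambda_0\in(0,\pi)$, $d\in(0,1/2)$, constants $c_f^\pm\ge 0$ with $c_f^++c_f^->0$, and functions $R_f^\pm:(0,\infty)\to[-c_f^\pm,\infty)$ with $R_f^\pm(x)\to0$ as $x\to0^+$, $$f_X(\lambda)=\begin{cases}\bigl(c_f^-+R_f^-(\lambda_0-\lambda)\bigr)(\lambda_0-\lambda)^{-2d}, & 0<\lambda<\lambda_0,\\ \bigl(c_f^++R_f^+(\lambda-\lambda_0)\bigr)(\lambda-\lambda_0)^{-2d}, & \lambda_0<\lambda<\pi.\end{cases}$$ Call a function $L:(a,\infty)\to(0,\infty)$, $a\ge 0$, slowly varying at $+\infty$ if it is measurable and $L(cx)/L(x)\to1$ as $x\to\infty$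 for every $c>0$; call it quasi-monotone if it is of bounded variation on $(a,x]$ for every $x>a$ and, for some $\delta>0$, $\int_{(a,x]}u^\delta\,|dL(u)|=O(x^\delta L(x))$ as $x\to\infty$, where $|dL|$ is the Lebesgue–Stieltjes measure of the total variation function of $L$. **Proposition B.2 (boundary case, from the spectral to the time domain).** Assume that $c_f^-=0$ and that, for some $\varepsilon\in(0,d)$, $$R_f^-(x)=L_f^-\!\left(\tfrac1x\right)x^{2\varepsilon}\ \ (0<x<\lambda_0),\qquad R_f^+(x)=L_f^+\!\left(\tfrac1x\right)-c_f^+\ \ (0<x<\pi-\lambda_0),$$ where $L_f^-:(1/\lambda_0,\infty)\to(0,\infty)$ and $L_f^+:(1/(\pi-\lambda_0),\infty)\to(0,\infty)$ are quasi-monotone slowly varying functions at $+\infty$, with $L_f^+(x)\sim c_f^+$ as $x\to\infty$. Then $X$ exhibits CLM in the time domain, in the boundary case, with the same $\lambda_0$ and $d$ and with $$c_\gamma=2\Gamma(1-2d)\,c_f^+>0,\qquad \phi=\left(\tfrac12-d\right)\pi;$$ that is, there is a function $R_\gamma:[0,\infty)\to\mathbb R$ with $R_\gamma(x)\to0$ as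 $x\to\infty$ such that $$\gamma_X(h)=\bigl(c_\gamma\cos(\lambda_0h+\phi)+R_\gamma(h)\bigr)h^{2d-1},\qquad h=1,2,3,\dots$$ -/

import Mathlib

open Set Filter MeasureTheory ProbabilityTheory Asymptotics
open scoped Topology Real

noncomputable section

/-! ### Second-order stationary series -/

/-- The real series `(X n)`, `n ∈ ℤ`, is second-order stationary under `P`: finite second moments,
constant mean, and covariances which depend only on the lag. -/
structure IsSecondOrderStationary {Ω : Type*} [MeasurableSpace Ω] (P : Measure Ω)
    (X : ℤ → Ω → ℝ) : Prop where
  memLp_two : ∀ n, MemLp (X n) 2 P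
  mean_eq : ∀ n, ∫ ω, X n ω ∂P = ∫ ω, X 0 ω ∂P
  cov_eq : ∀ n h, covariance (X (n + h)) (X n) P = covariance (X h) (X 0) P

/-- The autocovariance function `h ↦ Cov (X h, X 0)`. -/
def acvf {Ω : Type*} [MeasurableSpace Ω] (P : Measure Ω) (X : ℤ → Ω → ℝ) (h : ℤ) : ℝ :=
  covariance (X h) (X 0) P

/-- `f` is a spectral density, on `(-π, π)`, of the real autocovariance function `γ`: it is
nonnegative, even and integrable, and `γ h = ∫_{-π}^{π} e^{i h u} f u du` for every integer `h`. -/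
structure IsSpectralDensity (f : ℝ → ℝ) (γ : ℤ → ℝ) : Prop where
  nonneg : ∀ u ∈ Ioo (-π) π, 0 ≤ f u
  even : ∀ u ∈ Ioo (-π) π, f (-u) = f u
  integrable : IntegrableOn f (Ioo (-π) π)
  acvf_eq : ∀ h : ℤ, (γ h : ℂ) =
    ∫ u in Ioo (-π) π, Complex.exp (Complex.I * (h : ℂ) * (u : ℂ)) * (f u : ℂ)

/-! ### Quasi-monotone slowly varying functions on a half-line `(a, ∞)` -/

/-- `L : (a, ∞) → (0, ∞)` is slowly varying at `+∞`. Only the values on `(a, ∞)` matter. -/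
structure IsSlowlyVaryingOn (a : ℝ) (L : ℝ → ℝ) : Prop where
  pos : ∀ x ∈ Ioi a, 0 < L x
  measurable : Measurable (fun x : Ioi a => L x)
  tendsto_ratio : ∀ c : ℝ, 0 < c → Tendsto (fun x => L (c * x) / L x) atTop (𝓝 1)

/-- The total variation of `L` on `(a, x]`, as a function of `x`; it is `0` for `x ≤ a`. -/
def variationFrom (a : ℝ) (L : ℝ → ℝ) (x : ℝ) : ℝ := (eVariationOn L (Ioc a x)).toReal

theorem monotone_variationFrom {a : ℝ} {L : ℝ → ℝ}
    (hL : ∀ x, BoundedVariationOn L (Ioc a x)) : Monotone (variationFrom a L) := fun _ y hxy =>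
  ENNReal.toReal_mono (hL y) (eVariationOn.mono L (Ioc_subset_Ioc_right hxy))

/-- The Lebesgue-Stieltjes measure `|dL|` on `(a, ∞)`: the Stieltjes measure of the total variation
function of `L`. -/
def variationMeasure {a : ℝ} {L : ℝ → ℝ} (hL : ∀ x, BoundedVariationOn L (Ioc a x)) : Measure ℝ :=
  (monotone_variationFrom hL).stieltjesFunction.measure

/-- Quasi-monotonicity of `L : (a, ∞) → (0, ∞)`: `L` has bounded variation on each `(a, x]`, and
`∫_{(a, x]} u ^ δ |dL(u)| = O(x ^ δ L(x))` as `x → ∞`, for some `δ > 0`. -/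
def IsQuasiMonotoneOn (a : ℝ) (L : ℝ → ℝ) : Prop :=
  ∃ hL : ∀ x, BoundedVariationOn L (Ioc a x), ∃ δ : ℝ, 0 < δ ∧
    (fun x : ℝ => ∫ u in Ioc a x, u ^ δ ∂(variationMeasure hL)) =O[atTop]
      (fun x : ℝ => x ^ δ * L x)

/-! ### Cyclical long memory (CLM) -/

/-- Spectral-domain CLM, with cyclical frequency `lam`, memory parameter `d`, constants
`cm = c_f^-`, `cp = c_f^+` and remainders `Rm = R_f^-`, `Rp = R_f^+` (functions on `(0, ∞)`). -/
structure IsSpectralCLM {Ω : Type*} [MeasurableSpace Ω] (P : Measure Ω) (X : ℤ → Ω → ℝ)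
    (lam d cm cp : ℝ) (Rm Rp : ℝ → ℝ) : Prop where
  stationary : IsSecondOrderStationary P X
  lam_mem : lam ∈ Ioo 0 π
  d_mem : d ∈ Ioo (0 : ℝ) (1 / 2)
  cm_nonneg : 0 ≤ cm
  cp_nonneg : 0 ≤ cp
  c_pos : 0 < cp + cm
  Rm_ge : ∀ x, 0 < x → -cm ≤ Rm x
  Rp_ge : ∀ x, 0 < x → -cp ≤ Rp x
  Rm_tendsto : Tendsto Rm (𝓝[>] 0) (𝓝 0)
  Rp_tendsto : Tendsto Rp (𝓝[>] 0) (𝓝 0)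
  density : ∃ f : ℝ → ℝ, IsSpectralDensity f (acvf P X) ∧
    (∀ u, 0 < u → u < lam → f u = (cm + Rm (lam - u)) * (lam - u) ^ (-2 * d)) ∧
    (∀ u, lam < u → u < π → f u = (cp + Rp (u - lam)) * (u - lam) ^ (-2 * d))

/-- Time-domain CLM, with cyclical frequency `lam`, memory parameter `d`, constant `c = c_γ` and
cyclical phase `φ`. The identity is required at the lags `h ≥ 1`, where `h ^ (2 d - 1)` makes
sense. -/
structure IsTimeCLM {Ω : Type*} [MeasurableSpace Ω] (P : Measure Ω) (X : ℤ → Ω → ℝ)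
    (lam d c φ : ℝ) : Prop where
  stationary : IsSecondOrderStationary P X
  lam_mem : lam ∈ Ioo 0 π
  d_mem : d ∈ Ioo (0 : ℝ) (1 / 2)
  c_pos : 0 < c
  phase_mem : φ ∈ Icc (-((1 / 2 - d) * π)) ((1 / 2 - d) * π)
  acvf_eq : ∃ R : ℝ → ℝ, Tendsto R atTop (𝓝 0) ∧ ∀ h : ℕ, 1 ≤ h →
    acvf P X h = (c * Real.cos (lam * h + φ) + R h) * (h : ℝ) ^ (2 * d - 1)

/-- Time-domain CLM in the boundary case. -/
def IsBoundaryTimeCLM {Ω : Type*} [MeasurableSpace Ω] (P : Measure Ω) (X : ℤ → Ω → ℝ)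
    (lam d c φ : ℝ) : Prop :=
  IsTimeCLM P X lam d c φ ∧ (φ = -((1 / 2 - d) * π) ∨ φ = (1 / 2 - d) * π)

end

/-! With `h` the lag, folding by evenness gives `γ h = 2 Re ∫_0^π e^{ihu} f u du`, and splitting at
`lam` factors this as `2 Re (e^{i lam h} (conj J₋ + J₊))`, where `J₊` and `J₋` are the integrals over
`x > 0` of `e^{ihx} f (lam + x)` and `e^{ihx} f (lam - x)`
(`IsSpectralDensity.acvf_eq_two_mul_re`).

Put `p = 2 d`. Both integrals are covered by one Abelian theorem
(`tendsto_rpow_mul_integral_exp_mul`): if `g x = L (1 / x) x^{-s}` on `(0, b)` with `L` quasi-monotone,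
`0 < s ≤ p < 1`, and `g x x^p → c` as `x → 0+`, then
`h^{1-p} ∫_0^b e^{ihx} g x dx → c Γ(1-p) e^{i(1-p)π/2}`. It applies to `J₊` with `s = 2 d` and
`c = c_f^+`, and to `J₋` with `s = 2 d - 2 ε` and `c = 0`. Hence `h^{1-2d} γ h` differs by `o(1)` from
`2 c_f^+ Γ(1-2d) cos (lam h + (1/2 - d) π)`.

For the Abelian theorem, the integral is cut at `A / h`. Below the cut, rescaling and dominated
convergence give the limit `c ∫_0^A e^{ix} x^{-p} dx`, which is within a multiple of `A^{-p}` of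
`c Γ(1-p) e^{i(1-p)π/2}` (`norm_integral_exp_mul_rpow_sub_le`). Above the cut, an integral
`∫ e^{ihx} g` is at most `π / h` times a bound for `g` and its variation
(`norm_integral_exp_mul_le_of_antitoneOn`). Quasi-monotonicity bounds the variation of `L` over dyadic
blocks, and a geometric sum gives `O((h / A)^p)` for the variation of `g` on `(A / h, b)`
(`exists_variationFrom_mul_rpow_le`); so this part is at most a multiple of `A^{-p} h^{p-1}`. Finally
`A` is taken large.

The slowly varying functions enter only through their quasi-monotonicity and the limits of `R_f^±` at
`0`, which bound `L_f^-(u)` by a multiple of `u^{2ε}` and `L_f^+` by a constant near infinity. -/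

/-! ### Oscillatory integrals of functions of bounded variation -/

/-- A quantitative Riemann–Lebesgue estimate. The antitone function `U` controls the oscillation of
`g`: up to a constant, `-U` plays the role of the total variation function of `g`. Only the open
interval matters for `g`, so that nothing is asked of its values at the end points. -/
theorem norm_integral_exp_mul_le_of_antitoneOn {g U : ℝ → ℝ} {c b h M W : ℝ} (hcb : c < b)
    (hh : 0 < h) (hg : IntervalIntegrable g volume c b) (hM : ∀ x ∈ Ioo c b, |g x| ≤ M)
    (hU : AntitoneOn U (Icc c b)) (hU0 : ∀ x ∈ Icc c b, 0 ≤ U x) (hUW : ∀ x ∈ Icc c b, U x ≤ W)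
    (hgU : ∀ x ∈ Ioo c b, ∀ y ∈ Ioo c b, x ≤ y → |g y - g x| ≤ U x - U y) :
    ‖∫ x in c..b, Complex.exp ((h * x : ℝ) * Complex.I) * (g x : ℂ)‖ ≤ π / h * (M + W) := by
  -- With `t = π / h`, `F (x + t) = -F x`, so twice the integral is the integral of
  -- `F x * (g x - g (x + t))` over `(c, b - t)`, plus the integrals over the two end intervals of
  -- length `t`. The first is at most `∫ (U x - U (x + t))`, which telescopes to at most `t * W`.
  set F : ℝ → ℂ := fun x => Complex.exp ((h * x : ℝ) * Complex.I) with hF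
  set t : ℝ := π / h with ht
  have ht0 : 0 < t := by positivity
  have hFn : ∀ x, ‖F x‖ = 1 := fun x => Complex.norm_exp_ofReal_mul_I _
  have hFc : Continuous F := by fun_prop
  have hM0 : 0 ≤ M := (abs_nonneg _).trans (hM ((c + b) / 2) ⟨by linarith, by linarith⟩)
  have hW0 : 0 ≤ W := (hU0 c (left_mem_Icc.2 hcb.le)).trans (hUW c (left_mem_Icc.2 hcb.le))
  have hFg : IntervalIntegrable (fun x => F x * (g x : ℂ)) volume c b :=
    IntervalIntegrable.continuousOn_mul ⟨hg.1.ofReal, hg.2.ofReal⟩ hFc.continuousOn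
  have hsub : ∀ {u v}, c ≤ u → u ≤ v → v ≤ b → uIcc u v ⊆ uIcc c b := by
    intro u v h1 h2 h3
    rw [uIcc_of_le h2, uIcc_of_le hcb.le]
    exact Icc_subset_Icc h1 h3
  have hconst : ∀ u v, c ≤ u → u ≤ v → v ≤ b → ‖∫ x in u..v, F x * (g x : ℂ)‖ ≤ M * (v - u) := by
    intro u v h1 h2 h3
    have : ‖∫ x in u..v, F x * (g x : ℂ)‖ ≤ ∫ x in u..v, M := by
      refine (intervalIntegral.norm_integral_le_integral_norm h2).trans ?_
      refine intervalIntegral.integral_mono_on_of_le_Ioo h2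
        (hFg.mono_set (hsub h1 h2 h3)).norm (by simp) fun x hx => ?_
      rw [norm_mul, hFn, one_mul, Complex.norm_real]
      exact hM x ⟨h1.trans_lt hx.1, hx.2.trans_le h3⟩
    simpa [mul_comm] using this
  -- An interval shorter than half a period is covered by the trivial bound.
  by_cases hbt : b - c ≤ t
  · calc _ ≤ M * (b - c) := hconst c b le_rfl hcb.le le_rfl
      _ ≤ t * (M + W) := by nlinarith
  push Not at hbt
  -- Shifting by half a period flips the sign of the exponential.
  have hshift : ∀ x, F (x + t) = - F x := by
    intro x
    have : ((h * (x + t) : ℝ) : ℂ) * Complex.I = (h * x : ℝ) * Complex.I + π * Complex.I := by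
      have : h * (x + t) = h * x + π := by rw [ht]; field_simp
      rw [this]; push_cast; ring
    simp only [hF, this, Complex.exp_add, Complex.exp_pi_mul_I, mul_neg, mul_one]
  have i1 := hFg.mono_set (hsub (u := c) (v := c + t) le_rfl (by linarith) (by linarith))
  have i2 := hFg.mono_set (hsub (u := c + t) (v := b) (by linarith) (by linarith) (by linarith))
  have i3 := hFg.mono_set (hsub (u := c) (v := b - t) le_rfl (by linarith) (by linarith))
  have i4 := hFg.mono_set (hsub (u := b - t) (v := b) (by linarith) (by linarith) (by linarith))
  have e1 := intervalIntegral.integral_add_adjacent_intervals i1 i2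
  have e2 := intervalIntegral.integral_add_adjacent_intervals i3 i4
  have i5 : IntervalIntegrable (fun x => F x * (g (x + t) : ℂ)) volume c (b - t) := by
    have := i2.comp_add_right t
    simp only [add_sub_cancel_right] at this
    convert this.neg using 2 with x
    simp [hshift]
  have e3 : ∫ x in (c + t)..b, F x * (g x : ℂ) = - ∫ x in c..(b - t), F x * (g (x + t) : ℂ) := by
    rw [← intervalIntegral.integral_neg]
    have := intervalIntegral.integral_comp_add_right (a := c) (b := b - t)
      (fun x => F x * (g x : ℂ)) t
    rw [sub_add_cancel] at this
    rw [← this]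
    exact intervalIntegral.integral_congr fun x _ => by simp [hshift]
  have hUi : IntervalIntegrable U volume c b := by
    refine AntitoneOn.intervalIntegrable ?_
    rwa [uIcc_of_le hcb.le]
  have j1 := hUi.mono_set (hsub (u := c) (v := c + t) le_rfl (by linarith) (by linarith))
  have j2 := hUi.mono_set (hsub (u := c + t) (v := b) (by linarith) (by linarith) (by linarith))
  have j3 := hUi.mono_set (hsub (u := c) (v := b - t) le_rfl (by linarith) (by linarith))
  have j4 := hUi.mono_set (hsub (u := b - t) (v := b) (by linarith) (by linarith) (by linarith))
  have f1 := intervalIntegral.integral_add_adjacent_intervals j1 j2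
  have f2 := intervalIntegral.integral_add_adjacent_intervals j3 j4
  have j5 : IntervalIntegrable (fun x => U (x + t)) volume c (b - t) := by
    simpa only [add_sub_cancel_right] using j2.comp_add_right t
  have f3 : ∫ x in c..(b - t), U (x + t) = ∫ x in (c + t)..b, U x := by
    rw [intervalIntegral.integral_comp_add_right, sub_add_cancel]
  have k1 : ∫ x in c..(c + t), U x ≤ W * t := by
    have := intervalIntegral.integral_mono_on (by linarith) j1
      (intervalIntegrable_const (c := W)) fun x hx => hUW x ⟨hx.1, by linarith [hx.2]⟩
    simpa [mul_comm] using this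
  have k2 : 0 ≤ ∫ x in (b - t)..b, U x :=
    intervalIntegral.integral_nonneg (by linarith) fun x hx => hU0 x ⟨by linarith [hx.1], hx.2⟩
  have k3 : ‖∫ x in c..(b - t), (F x * (g x : ℂ) - F x * (g (x + t) : ℂ))‖ ≤
      ∫ x in c..(b - t), (U x - U (x + t)) := by
    refine (intervalIntegral.norm_integral_le_integral_norm (by linarith)).trans ?_
    refine intervalIntegral.integral_mono_on_of_le_Ioo (by linarith) (i3.sub i5).norm
      (j3.sub j5) fun x hx => ?_
    rw [← mul_sub, norm_mul, hFn, one_mul, ← Complex.ofReal_sub, Complex.norm_real, norm_sub_rev]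
    exact hgU x ⟨hx.1, by linarith [hx.2]⟩ (x + t) ⟨by linarith [hx.1], by linarith [hx.2]⟩
      (by linarith)
  rw [intervalIntegral.integral_sub j3 j5, f3] at k3
  rw [intervalIntegral.integral_sub i3 i5] at k3
  have m1 := hconst c (c + t) le_rfl (by linarith) (by linarith)
  have m2 := hconst (b - t) b (by linarith) (by linarith) le_rfl
  have key : 2 * ∫ x in c..b, F x * (g x : ℂ) = (∫ x in c..(c + t), F x * (g x : ℂ)) +
      (∫ x in (b - t)..b, F x * (g x : ℂ)) + ((∫ x in c..(b - t), F x * (g x : ℂ)) -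
        ∫ x in c..(b - t), F x * (g (x + t) : ℂ)) := by
    rw [e3] at e1
    linear_combination -e1 - e2
  have hn : 2 * ‖∫ x in c..b, F x * (g x : ℂ)‖ ≤ M * (c + t - c) + M * (b - (b - t)) + W * t := by
    have : 2 * ‖∫ x in c..b, F x * (g x : ℂ)‖ = ‖2 * ∫ x in c..b, F x * (g x : ℂ)‖ := by simp
    rw [this, key]
    refine (norm_add_le _ _).trans (add_le_add ((norm_add_le _ _).trans (add_le_add m1 m2)) ?_)
    linarith
  nlinarith [mul_nonneg hW0 ht0.le]

/-! ### The Fourier integral of a power -/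

/-- The Gamma integral at a complex rate. The left side is the complex moment generating function of
the measure `x ^ (s - 1) dx` on `(0, ∞)`, hence analytic in `z` on the left half-plane, and it agrees
with the right side on the negative real axis. -/
theorem integral_rpow_mul_cexp_mul_Ioi {s : ℝ} (hs : 0 < s) {z : ℂ} (hz : z.re < 0) :
    ∫ x in Ioi (0 : ℝ), ((x ^ (s - 1) : ℝ) : ℂ) * Complex.exp (z * x) =
      (-z) ^ (-(s : ℂ)) * Real.Gamma s := by
  set μ : Measure ℝ :=
    (volume.restrict (Ioi (0 : ℝ))).withDensity fun x => ENNReal.ofReal (x ^ (s - 1)) with hμ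
  have hmeas : Measurable fun x : ℝ => x ^ (s - 1) := by fun_prop
  have hint : ∀ t < 0, Integrable (fun x => Real.exp (t * x)) μ := by
    intro t ht
    rw [hμ, integrable_withDensity_iff_integrable_smul' (by fun_prop) (by simp)]
    have h2 : IntegrableOn (fun x : ℝ => x ^ (s - 1) * Real.exp (-(-t) * x)) (Ioi 0) := by
      have := integrableOn_rpow_mul_exp_neg_mul_rpow (p := 1) (s := s - 1) (b := -t) (by linarith)
        one_pos (by linarith)
      simpa using this
    refine h2.congr_fun (fun x hx => ?_) measurableSet_Ioi
    have : (0 : ℝ) ≤ x ^ (s - 1) := Real.rpow_nonneg (le_of_lt hx) _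
    simp [ENNReal.toReal_ofReal this]
  have hsub : Iio (0 : ℝ) ⊆ interior (integrableExpSet id μ) :=
    interior_maximal (fun t ht => hint t ht) isOpen_Iio
  have hmgf : ∀ w : ℂ, complexMGF id μ w =
      ∫ x in Ioi (0 : ℝ), ((x ^ (s - 1) : ℝ) : ℂ) * Complex.exp (w * x) := by
    intro w
    rw [complexMGF, hμ, integral_withDensity_eq_integral_toReal_smul (by fun_prop) (by simp)]
    refine setIntegral_congr_fun measurableSet_Ioi fun x hx => ?_
    have : (0 : ℝ) ≤ x ^ (s - 1) := Real.rpow_nonneg (le_of_lt hx) _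
    simp [ENNReal.toReal_ofReal this]
  have hopen : IsOpen {w : ℂ | w.re < 0} := isOpen_lt Complex.continuous_re continuous_const
  have hF : AnalyticOnNhd ℂ (complexMGF id μ) {w : ℂ | w.re < 0} := fun w hw =>
    analyticOnNhd_complexMGF w (hsub hw)
  have hG : AnalyticOnNhd ℂ (fun w : ℂ => (-w) ^ (-(s : ℂ)) * (Real.Gamma s : ℂ))
      {w : ℂ | w.re < 0} := by
    refine DifferentiableOn.analyticOnNhd (fun w hw => ?_) hopen
    refine DifferentiableAt.differentiableWithinAt ?_
    refine DifferentiableAt.mul_const ?_ _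
    refine DifferentiableAt.cpow (by fun_prop) (by fun_prop) (Or.inl ?_)
    simpa using hw
  have hreal : ∀ t : ℝ, t < 0 → complexMGF id μ (t : ℂ) = (-(t : ℂ)) ^ (-(s : ℂ)) * Real.Gamma s := by
    intro t ht
    rw [hmgf]
    have h1 := Complex.integral_cpow_mul_exp_neg_mul_Ioi (a := (s : ℂ)) (r := -t)
      (by simpa using hs) (by linarith)
    rw [Complex.Gamma_ofReal] at h1
    have h2 : (1 / ((-t : ℝ) : ℂ)) ^ (s : ℂ) = (-(t : ℂ)) ^ (-(s : ℂ)) := by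
      rw [one_div, Complex.inv_cpow, Complex.cpow_neg]
      · push_cast; rfl
      · rw [Complex.arg_ofReal_of_nonneg (by linarith)]; exact Real.pi_pos.ne
    rw [← h2, ← h1]
    refine setIntegral_congr_fun measurableSet_Ioi fun x hx => ?_
    rw [Complex.ofReal_cpow (le_of_lt hx)]
    push_cast
    congr 2
    ring
  have hfreq : ∃ᶠ w in 𝓝[≠] (-1 : ℂ),
      complexMGF id μ w = (-w) ^ (-(s : ℂ)) * (Real.Gamma s : ℂ) := by
    have ht : Tendsto (fun t : ℝ => (t : ℂ)) (𝓝[≠] (-1 : ℝ)) (𝓝[≠] (-1 : ℂ)) := by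
      refine tendsto_nhdsWithin_iff.2 ⟨?_, ?_⟩
      · refine Tendsto.mono_left ?_ nhdsWithin_le_nhds
        have := (Complex.continuous_ofReal).tendsto (-1 : ℝ)
        simpa using this
      · filter_upwards [self_mem_nhdsWithin] with t ht h
        exact ht (by simpa using congrArg Complex.re h)
    refine ht.frequently (Eventually.frequently ?_)
    refine Filter.Eventually.filter_mono nhdsWithin_le_nhds ?_
    filter_upwards [Iio_mem_nhds (show (-1 : ℝ) < 0 by norm_num)] with t ht
    exact hreal t ht
  have hpre : IsPreconnected {w : ℂ | w.re < 0} := (convex_halfSpace_re_lt 0).isPreconnected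
  rw [← hmgf]
  exact hF.eqOn_of_preconnected_of_frequently_eq hG hpre (by simp) hfreq hz

/-- The improper integral `∫ e^{ix} x^{-p}` over `(0, ∞)`, with an explicit rate of convergence. It
is obtained from the absolutely convergent integrals of `e^{(i - η) x} x^{-p}` by letting `η → 0+`:
the tails over `(A, ∞)` are bounded uniformly in `η` since `x^{-p} e^{-η x}` is decreasing. -/
theorem norm_integral_exp_mul_rpow_sub_le {p A : ℝ} (hp0 : 0 < p) (hp1 : p < 1) (hA : 0 < A) :
    ‖(∫ x in (0 : ℝ)..A, Complex.exp ((x : ℝ) * Complex.I) * ((x ^ (-p) : ℝ) : ℂ)) -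
      Real.Gamma (1 - p) * Complex.exp (((1 - p) / 2 * π : ℝ) * Complex.I)‖ ≤
      2 * π * A ^ (-p) := by
  have hz : ∀ η : ℝ, 0 < η → (-(η : ℂ) + Complex.I).re < 0 := fun η hη => by simpa using hη
  -- The damped integrals satisfy the bound uniformly in the damping.
  have hdamp : ∀ η : ℝ, 0 < η →
      ‖(∫ x in (0 : ℝ)..A, ((x ^ (-p) : ℝ) : ℂ) * Complex.exp ((-(η : ℂ) + Complex.I) * x)) -
        (-(-(η : ℂ) + Complex.I)) ^ (-((1 - p : ℝ) : ℂ)) * Real.Gamma (1 - p)‖ ≤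
        2 * π * A ^ (-p) := by
    intro η hη
    set f : ℝ → ℂ := fun x => ((x ^ (-p) : ℝ) : ℂ) * Complex.exp ((-(η : ℂ) + Complex.I) * x)
      with hf
    have hfull := integral_rpow_mul_cexp_mul_Ioi (s := 1 - p) (by linarith) (hz η hη)
    rw [show (1 - p - 1 : ℝ) = -p by ring] at hfull
    have hfi : IntegrableOn f (Ioi 0) := by
      have h1 : IntegrableOn (fun x : ℝ => x ^ (-p) * Real.exp (-η * x)) (Ioi 0) := by
        simpa using integrableOn_rpow_mul_exp_neg_mul_rpow (p := 1) (s := -p) (b := η)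
          (by linarith) one_pos hη
      refine Integrable.mono h1 (by fun_prop) (ae_of_all _ fun x => ?_)
      simp [hf, Complex.norm_exp]
    have hsplit : (∫ x in (0 : ℝ)..A, f x) + ∫ x in Ioi A, f x = ∫ x in Ioi (0 : ℝ), f x := by
      rw [intervalIntegral.integral_of_le hA.le, ← setIntegral_union Ioc_disjoint_Ioi_same
        measurableSet_Ioi (hfi.mono_set Ioc_subset_Ioi_self)
        (hfi.mono_set (Ioi_subset_Ioi hA.le)), Ioc_union_Ioi_eq_Ioi hA.le]
    rw [← hfull, ← hsplit, sub_add_cancel_left, norm_neg]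
    have hlim := intervalIntegral_tendsto_integral_Ioi A (hfi.mono_set (Ioi_subset_Ioi hA.le))
      tendsto_id
    refine le_of_tendsto hlim.norm ?_
    filter_upwards [eventually_gt_atTop A] with B hB
    set g : ℝ → ℝ := fun x => x ^ (-p) * Real.exp (-η * x) with hg
    have hanti : AntitoneOn g (Icc A B) := by
      intro x hx y hy hxy
      have hx0 : 0 < x := hA.trans_le hx.1
      refine mul_le_mul ?_ ?_ (Real.exp_nonneg _) (Real.rpow_nonneg hx0.le _)
      · exact Real.rpow_le_rpow_of_nonpos hx0 hxy (by linarith)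
      · exact Real.exp_le_exp.2 (by nlinarith)
    have hg0 : ∀ x ∈ Icc A B, 0 ≤ g x := fun x hx =>
      mul_nonneg (Real.rpow_nonneg (hA.le.trans hx.1) _) (Real.exp_nonneg _)
    have hgA : ∀ x ∈ Icc A B, g x ≤ A ^ (-p) := fun x hx => by
      have h1 : x ^ (-p) ≤ A ^ (-p) := Real.rpow_le_rpow_of_nonpos hA hx.1 (by linarith)
      have h2 : Real.exp (-η * x) ≤ 1 :=
        Real.exp_le_one_iff.2 (by nlinarith [hA.le.trans hx.1])
      calc g x ≤ A ^ (-p) * 1 := mul_le_mul h1 h2 (Real.exp_nonneg _) (Real.rpow_nonneg hA.le _)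
        _ = _ := mul_one _
    have := norm_integral_exp_mul_le_of_antitoneOn (g := g) (U := g) (h := 1) hB one_pos
      (by refine AntitoneOn.intervalIntegrable ?_; rwa [uIcc_of_le hB.le])
      (fun x hx => by
        rw [abs_of_nonneg (hg0 x (Ioo_subset_Icc_self hx))]; exact hgA x (Ioo_subset_Icc_self hx))
      hanti hg0 hgA (fun x hx y hy hxy => by
        rw [abs_sub_comm, abs_of_nonneg]
        linarith [hanti (Ioo_subset_Icc_self hx) (Ioo_subset_Icc_self hy) hxy])
    calc _ = _ := ?_
      _ ≤ _ := this
      _ = _ := by ring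
    congr 1
    refine intervalIntegral.integral_congr fun x _ => ?_
    simp only [hf, hg]
    push_cast
    rw [show (-(η : ℂ) + Complex.I) * x = (1 * x) * Complex.I + -η * x by ring, Complex.exp_add]
    ring
  have hl1 : Tendsto (fun η : ℝ => ∫ x in (0 : ℝ)..A,
      ((x ^ (-p) : ℝ) : ℂ) * Complex.exp ((-(η : ℂ) + Complex.I) * x)) (𝓝[>] 0)
      (𝓝 (∫ x in (0 : ℝ)..A, Complex.exp ((x : ℝ) * Complex.I) * ((x ^ (-p) : ℝ) : ℂ))) := by
    refine intervalIntegral.tendsto_integral_filter_of_dominated_convergence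
      (fun x => x ^ (-p)) (Eventually.of_forall fun η => ?_) ?_
      (intervalIntegral.intervalIntegrable_rpow' (by linarith)) (ae_of_all _ fun x _ => ?_)
    · exact (by fun_prop : Measurable fun x : ℝ =>
        ((x ^ (-p) : ℝ) : ℂ) * Complex.exp ((-(η : ℂ) + Complex.I) * x)).aestronglyMeasurable
    · filter_upwards [self_mem_nhdsWithin] with η hη
      refine ae_of_all _ fun x hx => ?_
      rw [uIoc_of_le hA.le] at hx
      have h0 : (0 : ℝ) ≤ x ^ (-p) := Real.rpow_nonneg hx.1.le _
      rw [norm_mul, Complex.norm_real, Real.norm_of_nonneg h0, Complex.norm_exp]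
      refine mul_le_of_le_one_right h0 (Real.exp_le_one_iff.2 ?_)
      simp only [mem_Ioi] at hη
      simp
      nlinarith [hx.1]
    · have : Continuous fun η : ℝ =>
          ((x ^ (-p) : ℝ) : ℂ) * Complex.exp ((-(η : ℂ) + Complex.I) * x) := by fun_prop
      have h := this.tendsto 0
      refine (h.mono_left nhdsWithin_le_nhds).trans_eq ?_
      simp [mul_comm]
  have hl2 : Tendsto (fun η : ℝ => (-(-(η : ℂ) + Complex.I)) ^ (-((1 - p : ℝ) : ℂ)) *
      (Real.Gamma (1 - p) : ℂ)) (𝓝[>] 0)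
      (𝓝 (Real.Gamma (1 - p) * Complex.exp (((1 - p) / 2 * π : ℝ) * Complex.I))) := by
    -- The limit point `-I` lies off the branch cut of the power.
    have hc : ContinuousAt (fun w : ℂ => w ^ (-((1 - p : ℝ) : ℂ))) (-Complex.I) :=
      continuousAt_cpow_const (by simp [Complex.mem_slitPlane_iff])
    have h1 : Tendsto (fun η : ℝ => -(-(η : ℂ) + Complex.I)) (𝓝[>] 0) (𝓝 (-Complex.I)) := by
      have : Continuous fun η : ℝ => -(-(η : ℂ) + Complex.I) := by fun_prop
      simpa using (this.tendsto 0).mono_left nhdsWithin_le_nhds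
    have h2 := (hc.tendsto.comp h1).mul_const (Real.Gamma (1 - p) : ℂ)
    refine h2.trans_eq ?_
    congr 1
    rw [mul_comm, Complex.cpow_def_of_ne_zero (by simp), Complex.log_neg_I]
    congr 2
    push_cast
    ring
  refine le_of_tendsto (hl1.sub hl2).norm ?_
  filter_upwards [self_mem_nhdsWithin] with η hη
  exact hdamp η hη

/-! ### Variation of quasi-monotone functions -/

theorem variationFrom_add_eVariationOn_Icc {a y z : ℝ} {L : ℝ → ℝ}
    (hL : ∀ x, BoundedVariationOn L (Ioc a x)) (hay : a < y) (hyz : y ≤ z) :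
    variationFrom a L y + (eVariationOn L (Icc y z)).toReal = variationFrom a L z := by
  have h : BoundedVariationOn L (Icc y z) :=
    (hL z).mono fun x hx => ⟨hay.trans_le hx.1, hx.2⟩
  have hu := eVariationOn.union L (s := Ioc a y) (t := Icc y z) (x := y)
    ⟨⟨hay, le_rfl⟩, fun x hx => hx.2⟩ ⟨⟨le_rfl, hyz⟩, fun x hx => hx.1⟩
  rw [variationFrom, variationFrom, ← ENNReal.toReal_add (hL y) h, ← hu,
    Ioc_union_Icc_eq_Ioc hay hyz]

/-- Quasi-monotonicity bounds the variation over a dyadic block by the value at its right end: on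
`(y / 2, 2 y]` the weight `u ^ δ` is comparable to `(2 y) ^ δ`, which cancels on both sides. The
block is widened to the left because the Stieltjes measure is that of the right limits of the
variation function. -/
theorem exists_eVariationOn_Icc_le_of_isQuasiMonotoneOn {a : ℝ} {L : ℝ → ℝ} (ha : 0 < a)
    (hq : IsQuasiMonotoneOn a L) :
    ∃ C : ℝ, 0 ≤ C ∧ ∀ᶠ y in atTop,
      eVariationOn L (Icc y (2 * y)) ≤ ENNReal.ofReal (C * |L (2 * y)|) := by
  obtain ⟨hL, δ, hδ, hO⟩ := hq
  obtain ⟨C, hC0, hC⟩ := hO.exists_nonneg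
  refine ⟨C * 4 ^ δ, by positivity, ?_⟩
  have h2 : Tendsto (fun y : ℝ => 2 * y) atTop atTop := tendsto_id.const_mul_atTop two_pos
  filter_upwards [h2.eventually hC.bound, eventually_gt_atTop (2 * a)] with y hy hya
  have hy0 : 0 < y := by linarith
  set m := variationMeasure hL with hm
  have hfin : ∀ u v : ℝ, m (Ioc u v) < ⊤ := fun u v => by
    rw [hm, variationMeasure, StieltjesFunction.measure_Ioc]; exact ENNReal.ofReal_lt_top
  have hint : IntegrableOn (fun u : ℝ => u ^ δ) (Ioc a (2 * y)) m := by
    refine Measure.integrableOn_of_bounded (M := (2 * y) ^ δ) (hfin _ _).ne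
      (Real.continuous_rpow_const hδ.le).aestronglyMeasurable ?_
    refine (ae_restrict_mem measurableSet_Ioc).mono fun u hu => ?_
    have hu0 : 0 ≤ u := (ha.trans hu.1).le
    rw [Real.norm_of_nonneg (Real.rpow_nonneg hu0 _)]
    exact Real.rpow_le_rpow hu0 hu.2 hδ.le
  have hsub : Ioc (y / 2) (2 * y) ⊆ Ioc a (2 * y) := Ioc_subset_Ioc_left (by linarith)
  have i1 : (y / 2) ^ δ * m.real (Ioc (y / 2) (2 * y)) ≤ ∫ u in Ioc (y / 2) (2 * y), u ^ δ ∂m := by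
    have := setIntegral_mono_on (μ := m) (s := Ioc (y / 2) (2 * y))
      (f := fun _ => (y / 2) ^ δ) (g := fun u => u ^ δ)
      (integrableOn_const (hfin _ _).ne) (hint.mono_set hsub) measurableSet_Ioc
      fun u hu => Real.rpow_le_rpow (by positivity) hu.1.le hδ.le
    simpa [mul_comm] using this
  have i2 : ∫ u in Ioc (y / 2) (2 * y), u ^ δ ∂m ≤ ∫ u in Ioc a (2 * y), u ^ δ ∂m := by
    refine setIntegral_mono_set hint ?_ hsub.eventuallyLE
    exact (ae_restrict_mem measurableSet_Ioc).mono fun u hu =>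
      Real.rpow_nonneg (ha.trans hu.1).le _
  have i3 : ∫ u in Ioc a (2 * y), u ^ δ ∂m ≤ C * ((2 * y) ^ δ * |L (2 * y)|) := by
    refine (le_abs_self _).trans ?_
    rwa [norm_mul, Real.norm_of_nonneg (Real.rpow_nonneg (by positivity) _), Real.norm_eq_abs,
      Real.norm_eq_abs] at hy
  have i4 : m.real (Ioc (y / 2) (2 * y)) ≤ C * 4 ^ δ * |L (2 * y)| := by
    have e : (2 * y) ^ δ = 4 ^ δ * (y / 2) ^ δ := by
      rw [← Real.mul_rpow (by norm_num) (by positivity)]; congr 1; ring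
    have hp : 0 < (y / 2) ^ δ := by positivity
    refine le_of_mul_le_mul_left ?_ hp
    refine (i1.trans (i2.trans i3)).trans_eq ?_
    rw [e]; ring
  have hmono := monotone_variationFrom hL
  have i5 : variationFrom a L (2 * y) - variationFrom a L y ≤ m.real (Ioc (y / 2) (2 * y)) := by
    rw [hm, variationMeasure, measureReal_def, StieltjesFunction.measure_Ioc,
      Monotone.stieltjesFunction_eq, Monotone.stieltjesFunction_eq]
    rw [ENNReal.toReal_ofReal']
    refine le_trans ?_ (le_max_left _ _)
    exact sub_le_sub (hmono.le_rightLim le_rfl) (hmono.rightLim_le (by linarith))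
  have i6 := variationFrom_add_eVariationOn_Icc hL (by linarith : a < y) (by linarith : y ≤ 2 * y)
  have hb : BoundedVariationOn L (Icc y (2 * y)) :=
    (hL (2 * y)).mono fun x hx => ⟨by linarith [hx.1], hx.2⟩
  rw [← ENNReal.ofReal_toReal hb]
  exact ENNReal.ofReal_le_ofReal (by linarith)

/-- A function whose increments over dyadic blocks are at most a multiple of `y ^ p` is itself at
most a multiple of `y ^ p`, since `p > 0` makes the sum over the blocks geometric. -/
theorem exists_le_mul_rpow_of_doubling {V : ℝ → ℝ} {D p y₀ : ℝ} (hV : Monotone V)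
    (hV0 : ∀ y, 0 ≤ V y) (hD : 0 ≤ D) (hp : 0 < p) (hy₀ : 0 < y₀)
    (h : ∀ y, y₀ ≤ y → V (2 * y) ≤ V y + D * y ^ p) :
    ∃ K, 0 ≤ K ∧ ∀ y, y₀ ≤ y → V y ≤ K * y ^ p := by
  have h2p : (1 : ℝ) < 2 ^ p := Real.one_lt_rpow one_lt_two hp
  have h2p' : (0 : ℝ) < 2 ^ p - 1 := by linarith
  -- The first term covers `[y₀, 2 y₀]`, and the second makes `K + D ≤ K * 2 ^ p`, which is the
  -- inequality needed to pass from `y` to `2 y`.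
  set K := V (2 * y₀) / y₀ ^ p + D / (2 ^ p - 1) with hK
  have hy₀p : 0 < y₀ ^ p := by positivity
  have hK1 : V (2 * y₀) ≤ K * y₀ ^ p := by
    rw [hK, add_mul, div_mul_cancel₀ _ hy₀p.ne']
    have : 0 ≤ D / (2 ^ p - 1) * y₀ ^ p := by positivity
    linarith
  have hK2 : K + D ≤ K * 2 ^ p := by
    have h1 : D / (2 ^ p - 1) ≤ K := by
      have : 0 ≤ V (2 * y₀) / y₀ ^ p := div_nonneg (hV0 _) hy₀p.le
      linarith
    have := mul_le_mul_of_nonneg_right h1 h2p'.le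
    rw [div_mul_cancel₀ _ h2p'.ne'] at this
    linarith
  have hK0 : 0 ≤ K := add_nonneg (div_nonneg (hV0 _) hy₀p.le) (div_nonneg hD h2p'.le)
  have hbase : ∀ y, y₀ ≤ y → y ≤ 2 * y₀ → V y ≤ K * y ^ p := fun y h1 h2 =>
    (hV h2).trans (hK1.trans (mul_le_mul_of_nonneg_left
      (Real.rpow_le_rpow hy₀.le h1 hp.le) hK0))
  have hind : ∀ n : ℕ, ∀ y, y₀ ≤ y → y ≤ 2 ^ n * (2 * y₀) → V y ≤ K * y ^ p := by
    intro n
    induction n with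
    | zero => intro y h1 h2; exact hbase y h1 (by simpa using h2)
    | succ n ih =>
      intro y h1 h2
      by_cases h3 : y ≤ 2 * y₀
      · exact hbase y h1 h3
      push Not at h3
      have h4 := ih (y / 2) (by linarith) (by rw [pow_succ] at h2; linarith)
      have h5 := h (y / 2) (by linarith)
      rw [mul_div_cancel₀ _ two_ne_zero] at h5
      have e : y ^ p = 2 ^ p * (y / 2) ^ p := by
        rw [← Real.mul_rpow (by norm_num) (by linarith)]; congr 1; ring
      have h6 : 0 ≤ (y / 2) ^ p := Real.rpow_nonneg (by linarith) _
      calc V y ≤ (K + D) * (y / 2) ^ p := by linarith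
        _ ≤ K * 2 ^ p * (y / 2) ^ p := mul_le_mul_of_nonneg_right hK2 h6
        _ = K * y ^ p := by rw [e]; ring
  refine ⟨K, hK0, fun y hy => ?_⟩
  obtain ⟨n, hn⟩ := pow_unbounded_of_one_lt (y / (2 * y₀)) one_lt_two
  exact hind n y hy (by rw [div_lt_iff₀ (by positivity)] at hn; exact hn.le)

theorem boundedVariationOn_mul_rpow {a s x : ℝ} {L : ℝ → ℝ} (ha : 0 < a) (hs : 0 ≤ s)
    (hL : BoundedVariationOn L (Ioc a x)) :
    BoundedVariationOn (fun u => L u * u ^ s) (Ioc a x) := by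
  refine hL.mul ?_
  refine MonotoneOn.boundedVariationOn (C := x ^ s) (fun u hu v hv huv => ?_) fun u hu => ?_
  · exact Real.rpow_le_rpow (ha.trans hu.1).le huv hs
  · rw [abs_of_nonneg (Real.rpow_nonneg (ha.trans hu.1).le _)]
    exact Real.rpow_le_rpow (ha.trans hu.1).le hu.2 hs

/-- If `L` is quasi-monotone and `O(u ^ (p - s))`, then `u ↦ L u * u ^ s` has variation
`O(y ^ p)` on `(a, y]`. -/
theorem exists_variationFrom_mul_rpow_le {a s p C : ℝ} {L : ℝ → ℝ} (ha : 0 < a)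
    (hq : IsQuasiMonotoneOn a L) (hs : 0 < s) (hsp : s ≤ p) (hC0 : 0 ≤ C)
    (hC : ∀ᶠ u in atTop, |L u| ≤ C * u ^ (p - s)) :
    ∃ K, 0 ≤ K ∧ ∀ᶠ y in atTop, variationFrom a (fun u => L u * u ^ s) y ≤ K * y ^ p := by
  obtain ⟨C₁, hC₁0, hC₁⟩ := exists_eVariationOn_Icc_le_of_isQuasiMonotoneOn ha hq
  obtain ⟨hL, -⟩ := hq
  obtain ⟨y₀, hy₀⟩ := eventually_atTop.1 (hC.and (hC₁.and (eventually_gt_atTop a)))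
  have hy₀a : a < y₀ := (hy₀ y₀ le_rfl).2.2
  have hG : ∀ x, BoundedVariationOn (fun u => L u * u ^ s) (Ioc a x) := fun x =>
    boundedVariationOn_mul_rpow ha hs.le (hL x)
  set D := C * 2 ^ p + C₁ * C * 2 ^ p with hD
  have hD0 : 0 ≤ D := by positivity
  obtain ⟨K, hK0, hK⟩ := exists_le_mul_rpow_of_doubling (V := variationFrom a fun u => L u * u ^ s)
    (D := D) (p := p) (y₀ := y₀) (monotone_variationFrom hG) (fun y => ENNReal.toReal_nonneg) hD0
    (hs.trans_le hsp) (ha.trans hy₀a) (fun y hy => by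
      have hay : a < y := hy₀a.trans_le hy
      have hy0 : 0 < y := ha.trans hay
      have hsplit := variationFrom_add_eVariationOn_Icc hG hay (by linarith : y ≤ 2 * y)
      rw [← hsplit]
      gcongr
      have hLb : ∀ u ∈ Icc y (2 * y), |L u| ≤ C * (2 * y) ^ (p - s) := fun u hu =>
        (hy₀ u (hy.trans hu.1)).1.trans (mul_le_mul_of_nonneg_left
          (Real.rpow_le_rpow (hy0.le.trans hu.1) hu.2 (by linarith)) hC0)
      have hmul := eVariationOn_fun_mul_le (f := L) (g := fun u : ℝ => u ^ s)
        (s := Icc y (2 * y)) (C := ENNReal.ofReal (C * (2 * y) ^ (p - s)))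
        (D := ENNReal.ofReal ((2 * y) ^ s))
        (fun u hu => by
          rw [Real.enorm_eq_ofReal_abs]; exact ENNReal.ofReal_le_ofReal (hLb u hu))
        (fun u hu => by
          have hu0 : 0 ≤ u := hy0.le.trans hu.1
          rw [Real.enorm_eq_ofReal_abs, abs_of_nonneg (Real.rpow_nonneg hu0 _)]
          exact ENNReal.ofReal_le_ofReal (Real.rpow_le_rpow hu0 hu.2 hs.le))
      have hpow : eVariationOn (fun u : ℝ => u ^ s) (Icc y (2 * y)) ≤
          ENNReal.ofReal ((2 * y) ^ s) := by
        have hmono : MonotoneOn (fun u : ℝ => u ^ s) (Icc y (2 * y)) := fun u hu v hv huv =>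
          Real.rpow_le_rpow (hy0.le.trans hu.1) huv hs.le
        have := hmono.eVariationOn_eq (left_mem_Icc.2 (by linarith : y ≤ 2 * y))
          (right_mem_Icc.2 (by linarith : y ≤ 2 * y))
        rw [inter_self] at this
        rw [this]
        exact ENNReal.ofReal_le_ofReal (by linarith [Real.rpow_nonneg hy0.le s])
      have hvL : eVariationOn L (Icc y (2 * y)) ≤
          ENNReal.ofReal (C₁ * (C * (2 * y) ^ (p - s))) :=
        (hy₀ y hy).2.1.trans (ENNReal.ofReal_le_ofReal (mul_le_mul_of_nonneg_left
          (hLb (2 * y) (right_mem_Icc.2 (by linarith))) hC₁0))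
      have hfin : eVariationOn (fun u => L u * u ^ s) (Icc y (2 * y)) ≤
          ENNReal.ofReal (D * y ^ p) := by
        refine hmul.trans ((add_le_add (mul_le_mul_right hpow _) (mul_le_mul_right hvL _)).trans ?_)
        rw [← ENNReal.ofReal_mul (by positivity), ← ENNReal.ofReal_mul (by positivity),
          ← ENNReal.ofReal_add (by positivity) (by positivity)]
        refine ENNReal.ofReal_le_ofReal (le_of_eq ?_)
        have e1 : (2 * y) ^ (p - s) * (2 * y) ^ s = 2 ^ p * y ^ p := by
          rw [← Real.rpow_add (by positivity), sub_add_cancel, Real.mul_rpow (by norm_num) hy0.le]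
        rw [hD]
        linear_combination (C + C₁ * C) * e1
      exact ENNReal.toReal_le_of_le_ofReal (by positivity) hfin)
  exact ⟨K, hK0, (eventually_ge_atTop y₀).mono hK⟩

/-! ### An Abelian theorem for Fourier integrals at a power singularity -/

theorem abs_sub_le_variationFrom_sub {a y z : ℝ} {L : ℝ → ℝ}
    (hL : ∀ x, BoundedVariationOn L (Ioc a x)) (hay : a < y) (hyz : y ≤ z) :
    |L z - L y| ≤ variationFrom a L z - variationFrom a L y := by
  rw [← variationFrom_add_eVariationOn_Icc hL hay hyz, add_sub_cancel_left, ← Real.dist_eq]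
  have h : BoundedVariationOn L (Icc y z) :=
    (hL z).mono fun x hx => ⟨hay.trans_le hx.1, hx.2⟩
  exact h.dist_le (right_mem_Icc.2 hyz) (left_mem_Icc.2 hyz)

/-- The part of the Fourier integral away from the singularity. The substitution `u = 1 / x` turns
`g` into `u ↦ L u * u ^ s`, whose variation on `(1 / b, y]` is `O(y ^ p)`. -/
theorem exists_norm_integral_tail_le {b s p C : ℝ} {L g : ℝ → ℝ} (hb : 0 < b)
    (hq : IsQuasiMonotoneOn (1 / b) L) (hs : 0 < s) (hsp : s ≤ p) (hC0 : 0 ≤ C)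
    (hC : ∀ᶠ u in atTop, |L u| ≤ C * u ^ (p - s))
    (hg : ∀ x ∈ Ioo 0 b, g x = L (1 / x) * x ^ (-s)) (hgi : IntervalIntegrable g volume 0 b) :
    ∃ K, ∀ᶠ y in atTop, ∀ h : ℝ, 0 < h →
      ‖∫ x in (1 / y)..b, Complex.exp ((h * x : ℝ) * Complex.I) * (g x : ℂ)‖ ≤
        π / h * (K * y ^ p) := by
  have ha : 0 < 1 / b := by positivity
  obtain ⟨K, hK0, hK⟩ := exists_variationFrom_mul_rpow_le ha hq hs hsp hC0 hC
  obtain ⟨hL, -⟩ := hq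
  set G : ℝ → ℝ := fun u => L u * u ^ s with hGdef
  have hG : ∀ x, BoundedVariationOn G (Ioc (1 / b) x) := fun x =>
    boundedVariationOn_mul_rpow ha hs.le (hL x)
  have hmono := monotone_variationFrom hG
  refine ⟨C + K + K, ?_⟩
  filter_upwards [hK, hC, eventually_gt_atTop (1 / b)] with y hKy hCy hby h hh
  have hy0 : 0 < y := ha.trans hby
  have hyb : 1 / y < b := by rwa [one_div_lt hy0 hb]
  have hgG : ∀ x ∈ Ioo (1 / y) b, g x = G (1 / x) ∧ 1 / b < 1 / x ∧ 1 / x < y ∧ 0 < x := by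
    intro x hx
    have hx0 : 0 < x := (by positivity : 0 < 1 / y).trans hx.1
    refine ⟨?_, one_div_lt_one_div_of_lt hx0 hx.2, by rw [one_div_lt hx0 hy0]; exact hx.1, hx0⟩
    rw [hg x ⟨hx0, hx.2⟩]
    simp only [hGdef]
    rw [Real.rpow_neg hx0.le, one_div, Real.inv_rpow hx0.le]
  have hGy : |G y| ≤ C * y ^ p := by
    simp only [hGdef]
    rw [abs_mul, abs_of_nonneg (Real.rpow_nonneg hy0.le _)]
    calc |L y| * y ^ s ≤ C * y ^ (p - s) * y ^ s := by gcongr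
      _ = C * y ^ p := by rw [mul_assoc, ← Real.rpow_add hy0, sub_add_cancel]
  have key := norm_integral_exp_mul_le_of_antitoneOn (g := g)
    (U := fun x => variationFrom (1 / b) G (1 / x)) (h := h) (M := C * y ^ p + K * y ^ p)
    (W := K * y ^ p) hyb hh
    (hgi.mono_set (by
      rw [uIcc_of_le hyb.le, uIcc_of_le hb.le]; exact Icc_subset_Icc_left (by positivity)))
    (fun x hx => by
      obtain ⟨e, h1, h2, -⟩ := hgG x hx
      have hd := abs_sub_le_variationFrom_sub hG h1 h2.le
      have hn : 0 ≤ variationFrom (1 / b) G (1 / x) := ENNReal.toReal_nonneg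
      rw [e]
      have := abs_sub_abs_le_abs_sub (G (1 / x)) (G y)
      rw [abs_sub_comm] at this
      linarith)
    (fun x hx z hz hxz => hmono (one_div_le_one_div_of_le
      ((by positivity : 0 < 1 / y).trans_le hx.1) hxz))
    (fun x _ => ENNReal.toReal_nonneg)
    (fun x hx => (hmono (by
      rw [one_div_le ((by positivity : 0 < 1 / y).trans_le hx.1) hy0]; exact hx.1)).trans hKy)
    (fun x hx z hz hxz => by
      obtain ⟨e, h1, h2, h3⟩ := hgG x hx
      obtain ⟨e', h1', h2', -⟩ := hgG z hz
      rw [e, e', abs_sub_comm]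
      exact abs_sub_le_variationFrom_sub hG h1' (one_div_le_one_div_of_le h3 hxz))
  refine key.trans_eq ?_
  ring

/-- The part of the Fourier integral within `A / h` of the singularity: after the change of scale
`x ↦ x / h` this is dominated convergence on `(0, A)`. -/
theorem tendsto_rpow_mul_integral_head {b p c A : ℝ} {g : ℝ → ℝ} (hb : 0 < b) (hp1 : p < 1)
    (hA : 0 < A) (hgi : IntervalIntegrable g volume 0 b)
    (hlim : Tendsto (fun x => g x * x ^ p) (𝓝[>] 0) (𝓝 c)) :
    Tendsto (fun h : ℝ => ((h ^ (1 - p) : ℝ) : ℂ) *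
      ∫ x in (0 : ℝ)..(A / h), Complex.exp ((h * x : ℝ) * Complex.I) * (g x : ℂ)) atTop
      (𝓝 (c * ∫ x in (0 : ℝ)..A, Complex.exp ((x : ℝ) * Complex.I) * ((x ^ (-p) : ℝ) : ℂ))) := by
  have hAh : Tendsto (fun h : ℝ => A / h) atTop (𝓝 0) := tendsto_const_nhds.div_atTop tendsto_id
  have hscale : ∀ h : ℝ, 0 < h → ((h ^ (1 - p) : ℝ) : ℂ) *
      ∫ x in (0 : ℝ)..(A / h), Complex.exp ((h * x : ℝ) * Complex.I) * (g x : ℂ) =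
      ∫ x in (0 : ℝ)..A,
        Complex.exp ((x : ℝ) * Complex.I) * ((h ^ (-p) * g (x / h) : ℝ) : ℂ) := by
    intro h hh
    have h1 := intervalIntegral.integral_comp_div (a := 0) (b := A) (c := h)
      (fun x => Complex.exp ((h * x : ℝ) * Complex.I) * (g x : ℂ)) hh.ne'
    rw [zero_div] at h1
    have e : (h ^ (1 - p) : ℝ) = h ^ (-p) * h := by
      rw [← Real.rpow_add_one hh.ne']; congr 1; ring
    rw [e, Complex.ofReal_mul, mul_assoc, ← Complex.real_smul (x := h), ← h1,
      ← intervalIntegral.integral_const_mul]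
    refine intervalIntegral.integral_congr fun x _ => ?_
    simp only [mul_div_cancel₀ x hh.ne']
    push_cast
    ring
  have hlim' : Tendsto (fun h : ℝ => ∫ x in (0 : ℝ)..A,
      Complex.exp ((x : ℝ) * Complex.I) * ((h ^ (-p) * g (x / h) : ℝ) : ℂ)) atTop
      (𝓝 (∫ x in (0 : ℝ)..A,
        Complex.exp ((x : ℝ) * Complex.I) * ((c * x ^ (-p) : ℝ) : ℂ))) := by
    have hr : ∀ x h : ℝ, 0 < x → 0 < h →
        h ^ (-p) * g (x / h) = g (x / h) * (x / h) ^ p * x ^ (-p) := by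
      intro x h hx hh
      rw [Real.div_rpow hx.le hh.le, Real.rpow_neg hx.le, Real.rpow_neg hh.le]
      have : x ^ p ≠ 0 := (Real.rpow_pos_of_pos hx p).ne'
      field_simp
    refine intervalIntegral.tendsto_integral_filter_of_dominated_convergence
      (fun x => (|c| + 1) * x ^ (-p)) ?_ ?_
      ((intervalIntegral.intervalIntegrable_rpow' (by linarith)).const_mul _)
      (ae_of_all _ fun x hx => ?_)
    · filter_upwards [eventually_gt_atTop 0, hAh.eventually_lt_const hb] with h hh hhb
      have h1 : IntervalIntegrable (fun x => g (x / h)) volume 0 A := by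
        have := (hgi.mono_set (c := 0) (d := A / h) (by
          rw [uIcc_of_le (by positivity), uIcc_of_le hb.le]; exact Icc_subset_Icc_right hhb.le)
          ).comp_mul_right (c := h⁻¹) (by simp)
        simpa [div_eq_mul_inv, hh.ne'] using this
      have h2 : AEStronglyMeasurable (fun x => ((h ^ (-p) * g (x / h) : ℝ) : ℂ))
          (volume.restrict (uIoc 0 A)) :=
        Complex.continuous_ofReal.comp_aestronglyMeasurable
          (h1.def'.aestronglyMeasurable.const_mul _)
      exact (by fun_prop : Continuous fun x : ℝ =>
        Complex.exp ((x : ℝ) * Complex.I)).aestronglyMeasurable.mul h2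
    · have hbd : ∀ᶠ x in 𝓝[>] (0 : ℝ), |g x * x ^ p| ≤ |c| + 1 :=
        (hlim.abs.eventually_lt_const (lt_add_one _)).mono fun _ => le_of_lt
      obtain ⟨r, hr0, hr1⟩ := mem_nhdsGT_iff_exists_Ioo_subset.1 hbd
      filter_upwards [eventually_gt_atTop 0, hAh.eventually_lt_const hr0] with h hh hhr
      refine ae_of_all _ fun x hx => ?_
      rw [uIoc_of_le hA.le] at hx
      have hx0 : 0 < x := hx.1
      rw [norm_mul, Complex.norm_exp_ofReal_mul_I, one_mul, Complex.norm_real, hr x h hx0 hh,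
        norm_mul, Real.norm_of_nonneg (Real.rpow_nonneg hx0.le _)]
      refine mul_le_mul_of_nonneg_right ?_ (Real.rpow_nonneg hx0.le _)
      exact hr1 ⟨by positivity, lt_of_le_of_lt (by gcongr; exact hx.2) hhr⟩
    · rw [uIoc_of_le hA.le] at hx
      have hx0 : 0 < x := hx.1
      have hxh : Tendsto (fun h : ℝ => x / h) atTop (𝓝[>] 0) := by
        refine tendsto_nhdsWithin_iff.2 ⟨tendsto_const_nhds.div_atTop tendsto_id, ?_⟩
        filter_upwards [eventually_gt_atTop 0] with h hh
        exact div_pos hx0 hh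
      have h1 : Tendsto (fun h : ℝ => h ^ (-p) * g (x / h)) atTop (𝓝 (c * x ^ (-p))) := by
        refine ((hlim.comp hxh).mul_const (x ^ (-p))).congr' ?_
        filter_upwards [eventually_gt_atTop 0] with h hh
        exact (hr x h hx0 hh).symm
      exact ((Complex.continuous_ofReal.tendsto _).comp h1).const_mul _
  have e : ∫ x in (0 : ℝ)..A, Complex.exp ((x : ℝ) * Complex.I) * ((c * x ^ (-p) : ℝ) : ℂ) =
      c * ∫ x in (0 : ℝ)..A, Complex.exp ((x : ℝ) * Complex.I) * ((x ^ (-p) : ℝ) : ℂ) := by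
    rw [← intervalIntegral.integral_const_mul]
    refine intervalIntegral.integral_congr fun x _ => ?_
    push_cast
    ring
  rw [← e]
  refine hlim'.congr' ?_
  filter_upwards [eventually_gt_atTop 0] with h hh
  exact (hscale h hh).symm

/-- A one-sided Abelian theorem for Fourier integrals at a power singularity `g x ∼ c * x ^ (-p)`,
where `c = 0` is allowed and then means that the integral is `o(h ^ (p - 1))`. -/
theorem tendsto_rpow_mul_integral_exp_mul {b s p c : ℝ} {L g : ℝ → ℝ} (hb : 0 < b)
    (hq : IsQuasiMonotoneOn (1 / b) L) (hs : 0 < s) (hsp : s ≤ p) (hp1 : p < 1)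
    (hg : ∀ x ∈ Ioo 0 b, g x = L (1 / x) * x ^ (-s)) (hgi : IntervalIntegrable g volume 0 b)
    (hlim : Tendsto (fun x => g x * x ^ p) (𝓝[>] 0) (𝓝 c)) :
    Tendsto (fun h : ℝ => ((h ^ (1 - p) : ℝ) : ℂ) *
      ∫ x in (0 : ℝ)..b, Complex.exp ((h * x : ℝ) * Complex.I) * (g x : ℂ)) atTop
      (𝓝 (c * (Real.Gamma (1 - p) * Complex.exp (((1 - p) / 2 * π : ℝ) * Complex.I)))) := by
  have hp0 : 0 < p := hs.trans_le hsp
  have hinv : Tendsto (fun u : ℝ => 1 / u) atTop (𝓝[>] 0) := by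
    simpa only [one_div] using tendsto_inv_atTop_nhdsGT_zero (𝕜 := ℝ)
  -- In the variable `u = 1 / x`, `g x * x ^ p` is `L u * u ^ (s - p)`, which is eventually bounded.
  have hC : ∀ᶠ u in atTop, |L u| ≤ (|c| + 1) * u ^ (p - s) := by
    filter_upwards [(hlim.comp hinv).abs.eventually_lt_const (lt_add_one _),
      eventually_gt_atTop (1 / b)] with u hu hub
    have hu0 : 0 < u := (by positivity : 0 < 1 / b).trans hub
    rw [Function.comp_apply, hg (1 / u) ⟨by positivity, by rwa [one_div_lt hu0 hb]⟩, one_div_one_div, one_div,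
      Real.inv_rpow hu0.le, Real.inv_rpow hu0.le, Real.rpow_neg hu0.le, inv_inv, mul_assoc,
      ← Real.rpow_neg hu0.le, ← Real.rpow_add hu0, abs_mul,
      abs_of_nonneg (Real.rpow_nonneg hu0.le _)] at hu
    have e : u ^ (s + -p) * u ^ (p - s) = 1 := by
      rw [← Real.rpow_add hu0, show s + -p + (p - s) = 0 by ring, Real.rpow_zero]
    calc |L u| = |L u| * u ^ (s + -p) * u ^ (p - s) := by rw [mul_assoc, e, mul_one]
      _ ≤ _ := by gcongr
  obtain ⟨K, hK⟩ := exists_norm_integral_tail_le hb hq hs hsp (by positivity) hC hg hgi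
  set J : ℂ := Real.Gamma (1 - p) * Complex.exp (((1 - p) / 2 * π : ℝ) * Complex.I) with hJ
  rw [Metric.tendsto_atTop']
  intro τ hτ
  -- Choose `A` so that the truncation error of the model integral and the tail are both small.
  have hsmall : Tendsto (fun A : ℝ => (|c| * (2 * π) + π * K) * A ^ (-p)) atTop (𝓝 0) := by
    simpa using (tendsto_rpow_neg_atTop hp0).const_mul (|c| * (2 * π) + π * K)
  obtain ⟨A, hAτ, hA⟩ :=
    ((hsmall.eventually_lt_const (half_pos hτ)).and (eventually_gt_atTop 0)).exists
  have hhead := tendsto_rpow_mul_integral_head hb hp1 hA hgi hlim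
  have hmodel := norm_integral_exp_mul_rpow_sub_le hp0 hp1 hA
  rw [← hJ] at hmodel
  set IA : ℂ := ∫ x in (0 : ℝ)..A, Complex.exp ((x : ℝ) * Complex.I) * ((x ^ (-p) : ℝ) : ℂ)
  have hhA : Tendsto (fun h : ℝ => h / A) atTop atTop := tendsto_id.atTop_div_const hA
  have hAh : Tendsto (fun h : ℝ => A / h) atTop (𝓝 0) := tendsto_const_nhds.div_atTop tendsto_id
  have hev : ∀ᶠ h in atTop, dist (((h ^ (1 - p) : ℝ) : ℂ) *
      ∫ x in (0 : ℝ)..b, Complex.exp ((h * x : ℝ) * Complex.I) * (g x : ℂ)) (c * J) < τ := by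
    filter_upwards [hhead.eventually (Metric.ball_mem_nhds _ (half_pos hτ)), hhA.eventually hK,
      eventually_gt_atTop 0, hAh.eventually_lt_const hb] with h h1 h2 hh hhb
    have h3 := h2 h hh
    rw [one_div_div] at h3
    have hFg : IntervalIntegrable (fun x => Complex.exp ((h * x : ℝ) * Complex.I) * (g x : ℂ))
        volume 0 b :=
      IntervalIntegrable.continuousOn_mul ⟨hgi.1.ofReal, hgi.2.ofReal⟩
        (by fun_prop : Continuous fun x : ℝ =>
          Complex.exp ((h * x : ℝ) * Complex.I)).continuousOn
    have hAh0 : 0 < A / h := by positivity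
    have hsplit := intervalIntegral.integral_add_adjacent_intervals
      (hFg.mono_set (c := 0) (d := A / h) (by
        rw [uIcc_of_le hAh0.le, uIcc_of_le hb.le]; exact Icc_subset_Icc_right hhb.le))
      (hFg.mono_set (c := A / h) (d := b) (by
        rw [uIcc_of_le hhb.le, uIcc_of_le hb.le]; exact Icc_subset_Icc_left hAh0.le))
    have htail : ‖((h ^ (1 - p) : ℝ) : ℂ) *
        ∫ x in (A / h)..b, Complex.exp ((h * x : ℝ) * Complex.I) * (g x : ℂ)‖ ≤
        π * K * A ^ (-p) := by
      rw [norm_mul, Complex.norm_real, Real.norm_of_nonneg (Real.rpow_nonneg hh.le _)]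
      refine (mul_le_mul_of_nonneg_left h3 (Real.rpow_nonneg hh.le _)).trans_eq ?_
      rw [Real.div_rpow hh.le hA.le, Real.rpow_neg hA.le, Real.rpow_sub hh, Real.rpow_one]
      have : h ^ p ≠ 0 := (Real.rpow_pos_of_pos hh p).ne'
      field_simp
    rw [dist_eq_norm] at h1
    rw [dist_eq_norm, ← hsplit]
    set H : ℂ := ∫ x in (0 : ℝ)..(A / h), Complex.exp ((h * x : ℝ) * Complex.I) * (g x : ℂ)
    set T : ℂ := ∫ x in (A / h)..b, Complex.exp ((h * x : ℝ) * Complex.I) * (g x : ℂ)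
    have e : ((h ^ (1 - p) : ℝ) : ℂ) * (H + T) - c * J =
        (((h ^ (1 - p) : ℝ) : ℂ) * H - c * IA) + c * (IA - J) + ((h ^ (1 - p) : ℝ) : ℂ) * T := by
      ring
    have h4 : ‖(c : ℂ) * (IA - J)‖ ≤ |c| * (2 * π * A ^ (-p)) := by
      rw [norm_mul, Complex.norm_real, Real.norm_eq_abs]
      gcongr
    rw [e]
    refine (norm_add₃_le).trans_lt ?_
    nlinarith
  obtain ⟨N, hN⟩ := eventually_atTop.1 hev
  exact ⟨N, fun h hh => hN h hh.le⟩

/-! ### From the spectral to the time domain -/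


open scoped ComplexConjugate in
theorem conj_integral_exp_mul (g : ℝ → ℝ) (h b : ℝ) :
    conj (∫ x in (0 : ℝ)..b, Complex.exp ((h * x : ℝ) * Complex.I) * (g x : ℂ)) =
      ∫ x in (0 : ℝ)..b, Complex.exp ((-(h * x) : ℝ) * Complex.I) * (g x : ℂ) := by
  rw [← intervalIntegral.intervalIntegral_conj]
  refine intervalIntegral.integral_congr fun x _ => ?_
  simp [← Complex.exp_conj]

open scoped ComplexConjugate in
/-- The autocovariance as the real part of two Fourier integrals on the two sides of `lam`, with the
carrier `e^{i lam h}` factored out. Evenness of `f` folds `(-π, π)` onto `(0, π)`. -/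
theorem IsSpectralDensity.acvf_eq_two_mul_re {f : ℝ → ℝ} {γ : ℤ → ℝ} (hf : IsSpectralDensity f γ)
    {lam : ℝ} (hlam : lam ∈ Ioo 0 π) (h : ℕ) :
    γ h = 2 * (Complex.exp ((lam * h : ℝ) * Complex.I) *
      (conj (∫ x in (0 : ℝ)..lam, Complex.exp ((h * x : ℝ) * Complex.I) * (f (lam - x) : ℂ)) +
        ∫ x in (0 : ℝ)..(π - lam),
          Complex.exp ((h * x : ℝ) * Complex.I) * (f (lam + x) : ℂ))).re := by
  obtain ⟨h0, hπ⟩ := hlam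
  have hpi := Real.pi_pos
  set F : ℝ → ℂ := fun u => Complex.exp ((h * u : ℝ) * Complex.I) * (f u : ℂ) with hF
  have hfi : IntervalIntegrable f volume (-π) π := by
    rw [intervalIntegrable_iff_integrableOn_Ioo_of_le (by linarith)]
    exact hf.integrable
  have hFi : IntervalIntegrable F volume (-π) π :=
    IntervalIntegrable.continuousOn_mul ⟨hfi.1.ofReal, hfi.2.ofReal⟩
      (by fun_prop : Continuous fun u : ℝ => Complex.exp ((h * u : ℝ) * Complex.I)).continuousOn
  have hsub : ∀ {u v}, -π ≤ u → u ≤ v → v ≤ π → IntervalIntegrable F volume u v := by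
    intro u v h1 h2 h3
    refine hFi.mono_set ?_
    rw [uIcc_of_le h2, uIcc_of_le (by linarith)]
    exact Icc_subset_Icc h1 h3
  have e0 : (γ h : ℂ) = ∫ u in (-π)..π, F u := by
    rw [hf.acvf_eq, intervalIntegral.integral_of_le (by linarith), integral_Ioc_eq_integral_Ioo]
    refine setIntegral_congr_fun measurableSet_Ioo fun u _ => ?_
    simp only [hF]
    congr 2
    push_cast
    ring
  have e1 : ∫ u in (-π)..π, F u = (∫ u in (-π)..0, F u) + ∫ u in (0 : ℝ)..π, F u :=
    (intervalIntegral.integral_add_adjacent_intervals (hsub le_rfl (by linarith) hpi.le)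
      (hsub (by linarith) hpi.le le_rfl)).symm
  have e2 : ∫ u in (-π)..0, F u = conj (∫ u in (0 : ℝ)..π, F u) := by
    have := intervalIntegral.integral_comp_neg (a := 0) (b := π) F
    rw [neg_zero] at this
    rw [← this, conj_integral_exp_mul, intervalIntegral.integral_of_le hpi.le,
      intervalIntegral.integral_of_le hpi.le, integral_Ioc_eq_integral_Ioo,
      integral_Ioc_eq_integral_Ioo]
    refine setIntegral_congr_fun measurableSet_Ioo fun u hu => ?_
    simp only [hF]
    rw [hf.even u ⟨by linarith [hu.1], hu.2⟩, mul_neg]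
  have e3 : ∫ u in (0 : ℝ)..π, F u = (∫ u in (0 : ℝ)..lam, F u) + ∫ u in lam..π, F u :=
    (intervalIntegral.integral_add_adjacent_intervals (hsub (by linarith) h0.le hπ.le)
      (hsub (by linarith) hπ.le le_rfl)).symm
  have e4 : ∫ u in (0 : ℝ)..lam, F u = Complex.exp ((lam * h : ℝ) * Complex.I) *
      conj (∫ x in (0 : ℝ)..lam, Complex.exp ((h * x : ℝ) * Complex.I) * (f (lam - x) : ℂ)) := by
    rw [conj_integral_exp_mul (fun x => f (lam - x)), ← intervalIntegral.integral_const_mul]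
    have := intervalIntegral.integral_comp_sub_left (a := 0) (b := lam) F lam
    rw [sub_self, sub_zero] at this
    rw [← this]
    refine intervalIntegral.integral_congr fun x _ => ?_
    simp only [hF]
    rw [← mul_assoc, ← Complex.exp_add]
    congr 2
    push_cast
    ring
  have e5 : ∫ u in lam..π, F u = Complex.exp ((lam * h : ℝ) * Complex.I) *
      ∫ x in (0 : ℝ)..(π - lam), Complex.exp ((h * x : ℝ) * Complex.I) * (f (lam + x) : ℂ) := by
    rw [← intervalIntegral.integral_const_mul]
    have := intervalIntegral.integral_comp_add_left (a := 0) (b := π - lam) F lam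
    rw [add_zero, add_sub_cancel] at this
    rw [← this]
    refine intervalIntegral.integral_congr fun x _ => ?_
    simp only [hF]
    rw [← mul_assoc, ← Complex.exp_add]
    congr 2
    push_cast
    ring
  have e6 := congrArg Complex.re (e0.trans (e1.trans (by rw [e2])))
  rw [Complex.ofReal_re, Complex.add_re, Complex.conj_re] at e6
  rw [e6, mul_add, ← e4, ← e5, ← e3]
  ring

theorem propositionB2 {Ω : Type*} [MeasurableSpace Ω] (P : Measure Ω) [IsProbabilityMeasure P]
    (X : ℤ → Ω → ℝ) (lam d cp ε : ℝ) (Rm Rp Lm Lp : ℝ → ℝ)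
    (hε : ε ∈ Ioo 0 d)
    (hLm_slow : IsSlowlyVaryingOn (1 / lam) Lm)
    (hLm_quasi : IsQuasiMonotoneOn (1 / lam) Lm)
    (hLp_slow : IsSlowlyVaryingOn (1 / (π - lam)) Lp)
    (hLp_quasi : IsQuasiMonotoneOn (1 / (π - lam)) Lp)
    (hLp_equiv : Lp ~[atTop] fun _ => cp)
    (hRm : ∀ x ∈ Ioo 0 lam, Rm x = Lm (1 / x) * x ^ (2 * ε))
    (hRp : ∀ x ∈ Ioo 0 (π - lam), Rp x = Lp (1 / x) - cp)
    (hX : IsSpectralCLM P X lam d 0 cp Rm Rp) :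
    IsBoundaryTimeCLM P X lam d (2 * Real.Gamma (1 - 2 * d) * cp) ((1 / 2 - d) * π) := by
  obtain ⟨h0, hπ⟩ := hX.lam_mem
  obtain ⟨hd0, hd1⟩ := hX.d_mem
  have hpi := Real.pi_pos
  have hcp : 0 < cp := by simpa using hX.c_pos
  have hφ : 0 ≤ (1 / 2 - d) * π := mul_nonneg (by linarith) hpi.le
  have hΓ : 0 < Real.Gamma (1 - 2 * d) := Real.Gamma_pos_of_pos (by linarith)
  refine ⟨⟨hX.stationary, hX.lam_mem, hX.d_mem, by positivity, ⟨by linarith, le_rfl⟩, ?_⟩,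
    Or.inr rfl⟩
  obtain ⟨f, hf, hfm, hfp⟩ := hX.density
  have hπl : 0 < π - lam := by linarith
  have hfi : ∀ {u v}, -π ≤ u → u ≤ v → v ≤ π → IntervalIntegrable f volume u v := by
    intro u v h1 h2 h3
    have : IntervalIntegrable f volume (-π) π := by
      rw [intervalIntegrable_iff_integrableOn_Ioo_of_le (by linarith)]
      exact hf.integrable
    refine this.mono_set ?_
    rw [uIcc_of_le h2, uIcc_of_le (by linarith)]
    exact Icc_subset_Icc h1 h3
  have hcancel : ∀ x : ℝ, 0 < x → x ^ (-2 * d) * x ^ (2 * d) = 1 := fun x hx => by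
    rw [← Real.rpow_add hx]; simp
  -- The side of `lam` with `c_f^+ > 0` carries the leading term.
  have hplus := tendsto_rpow_mul_integral_exp_mul (b := π - lam) (s := 2 * d) (p := 2 * d)
    (c := cp) (L := Lp) (g := fun x => f (lam + x)) hπl hLp_quasi (by linarith) le_rfl
    (by linarith)
    (fun x hx => by
      rw [hfp (lam + x) (by linarith [hx.1]) (by linarith [hx.2]), add_sub_cancel_left, hRp x hx,
        add_sub_cancel, neg_mul])
    (by simpa using (hfi (u := lam) (v := π) (by linarith) hπ.le le_rfl).comp_add_left lam)
    (by
      have h1 : Tendsto (fun x => cp + Rp x) (𝓝[>] 0) (𝓝 cp) := by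
        simpa using hX.Rp_tendsto.const_add cp
      refine h1.congr' ?_
      filter_upwards [Ioo_mem_nhdsGT hπl] with x hx
      rw [hfp (lam + x) (by linarith [hx.1]) (by linarith [hx.2]), add_sub_cancel_left, mul_assoc,
        hcancel x hx.1, mul_one])
  -- On the other side the density is `Rm x * x ^ (-2 d)` with `Rm x → 0`, so that the same theorem
  -- applies with `c = 0`; the power of `x` next to `Lm (1 / x)` is `-(2 d - 2 ε)`.
  have hminus := tendsto_rpow_mul_integral_exp_mul (b := lam) (s := 2 * d - 2 * ε) (p := 2 * d)
    (c := 0) (L := Lm) (g := fun x => f (lam - x)) h0 hLm_quasi (by linarith [hε.2])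
    (by linarith [hε.1]) (by linarith)
    (fun x hx => by
      rw [hfm (lam - x) (by linarith [hx.2]) (by linarith [hx.1]), sub_sub_cancel, hRm x hx,
        zero_add, mul_assoc, ← Real.rpow_add hx.1]
      congr 2
      ring)
    (by
      have := (hfi (u := 0) (v := lam) (by linarith) h0.le hπ.le).comp_sub_left lam
      rw [sub_zero, sub_self] at this
      exact this.symm)
    (by
      refine hX.Rm_tendsto.congr' ?_
      filter_upwards [Ioo_mem_nhdsGT h0] with x hx
      rw [hfm (lam - x) (by linarith [hx.2]) (by linarith [hx.1]), sub_sub_cancel, zero_add,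
        mul_assoc, hcancel x hx.1, mul_one])
  rw [Complex.ofReal_zero, zero_mul] at hminus
  have hsum := (((Complex.continuous_conj.tendsto _).comp hminus).add hplus).comp
    (tendsto_natCast_atTop_atTop (R := ℝ))
  rw [map_zero, zero_add] at hsum
  set z : ℂ := cp * (Real.Gamma (1 - 2 * d) *
    Complex.exp (((1 - 2 * d) / 2 * π : ℝ) * Complex.I)) with hz
  set r : ℕ → ℝ := fun n => acvf P X n * (n : ℝ) ^ (1 - 2 * d) -
    2 * Real.Gamma (1 - 2 * d) * cp * Real.cos (lam * n + (1 / 2 - d) * π) with hr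
  have hmodel : ∀ n : ℕ, 2 * Real.Gamma (1 - 2 * d) * cp * Real.cos (lam * n + (1 / 2 - d) * π) =
      2 * (Complex.exp ((lam * n : ℝ) * Complex.I) * z).re := by
    intro n
    have : Complex.exp ((lam * n : ℝ) * Complex.I) * z = ((Real.Gamma (1 - 2 * d) * cp : ℝ) : ℂ) *
        Complex.exp ((lam * n + (1 / 2 - d) * π : ℝ) * Complex.I) := by
      have e : ((lam * n + (1 / 2 - d) * π : ℝ) : ℂ) * Complex.I =
          (lam * n : ℝ) * Complex.I + ((1 - 2 * d) / 2 * π : ℝ) * Complex.I := by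
        push_cast; ring
      rw [e, Complex.exp_add, hz]
      push_cast
      ring
    rw [this, Complex.re_ofReal_mul, Complex.exp_ofReal_mul_I_re]
    ring
  have hr0 : Tendsto r atTop (𝓝 0) := by
    have hb := ((hsum.sub_const z).norm).const_mul 2
    rw [sub_self, norm_zero, mul_zero] at hb
    refine squeeze_zero_norm (fun n => ?_) hb
    have hγ := hf.acvf_eq_two_mul_re hX.lam_mem n
    rw [Real.norm_eq_abs]
    simp only [hr, hmodel, Function.comp]
    rw [hγ, map_mul, Complex.conj_ofReal, ← mul_add, mul_assoc, mul_comm _ ((n : ℝ) ^ (1 - 2 * d)),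
      ← Complex.re_ofReal_mul, ← mul_sub, ← Complex.sub_re, mul_left_comm, ← mul_sub, abs_mul,
      abs_two]
    refine mul_le_mul_of_nonneg_left ((Complex.abs_re_le_norm _).trans_eq ?_) two_pos.le
    rw [norm_mul, Complex.norm_exp_ofReal_mul_I, one_mul]
  -- Only the values of the remainder at integers matter; it is extended as a step function.
  refine ⟨fun x => r ⌊x⌋₊, hr0.comp tendsto_nat_floor_atTop, fun n hn => ?_⟩
  have hn0 : (0 : ℝ) < n := by exact_mod_cast hn
  have e : (n : ℝ) ^ (1 - 2 * d) * (n : ℝ) ^ (2 * d - 1) = 1 := by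
    rw [← Real.rpow_add hn0]; simp
  simp only [Nat.floor_natCast, hr]
  rw [add_sub_cancel, mul_assoc, e, mul_one]
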